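/- A smooth manifold is a second-countable Hausdorff topological space $M$ together with a smooth atlas: a family of charts, each a homeomorphism $\phi_U : U \to \phi_U(U)$ from an open set $U \subseteq M$ onto an open subset of some $\mathbb{R}^{n(U)}$, such that the sets $U$ cover $M$ and all transition maps $\phi_V \circ \phi_U^{-1}$ are $C^\infty$ on their domain of definition. The dimension $n(U)$ is finite but may vary with the chart, and need not be bounded on $M$. A map $f : M \to N$ between smooth manifolds is smooth if it is continuous and $\psi_V \circ f \circ \phi_U^{-1}$ is $C^\infty$ on its domain of definition for all charts $\phi_U$ of $M$ and $\psi_V$ of $N$. Let $\mathbf{Man}$ be the category of smooth manifolds and smooth maps; it has finite products, given by the one-point manifold and the product manifolds. **Theorem.** The category $\mathbf{Man}$ is not cartesian closed; that is, it is not the case that for every smooth manifold $M$ the functor $M \times - : \mathbf{Man} \to \mathbf{Man}$ has a right adjoint. -/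

import Mathlib

open CategoryTheory CategoryTheory.Limits
open scoped ContDiff

/-- A chart on `X`: a homeomorphism from an open subset of `X` onto an open subset of some `ℝⁿ`.
The dimension `n` is part of the data, so that it may vary from chart to chart. -/
abbrev EuclideanChart (X : Type) [TopologicalSpace X] : Type :=
  Σ n : ℕ, OpenPartialHomeomorph X (EuclideanSpace ℝ (Fin n))

/-- `f`, read in the charts `c` and `d`, is smooth on its domain of definition. -/
def SmoothInCharts {X Y : Type} [TopologicalSpace X] [TopologicalSpace Y]
    (c : EuclideanChart X) (d : EuclideanChart Y) (f : X → Y) : Prop :=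
  ContDiffOn ℝ ∞ (fun v => d.2 (f (c.2.symm v))) {v | v ∈ c.2.target ∧ f (c.2.symm v) ∈ d.2.source}

/-- Smooth manifolds: second-countable Hausdorff spaces with a smooth atlas, whose charts may have
different finite dimensions. -/
structure Man : Type 1 where
  /-- the points of the manifold -/
  carrier : Type
  [top : TopologicalSpace carrier]
  [t2 : T2Space carrier]
  [secondCountable : SecondCountableTopology carrier]
  /-- the smooth atlas -/
  atlas : Set (EuclideanChart carrier)
  cover : ∀ x : carrier, ∃ c ∈ atlas, x ∈ c.2.source
  compatible : ∀ c ∈ atlas, ∀ d ∈ atlas, SmoothInCharts c d id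

namespace Man

attribute [instance] Man.top Man.t2 Man.secondCountable

instance : CoeSort Man Type where
  coe M := M.carrier

/-- A function between manifolds is smooth if it is continuous and smooth in all charts. -/
def IsSmooth {M N : Man} (f : M → N) : Prop :=
  Continuous f ∧ ∀ c ∈ M.atlas, ∀ d ∈ N.atlas, SmoothInCharts c d f

theorem smoothInCharts_of_contDiffAt {X Y : Type} [TopologicalSpace X] [TopologicalSpace Y]
    {c : EuclideanChart X} {d : EuclideanChart Y} {f : X → Y}
    (h : ∀ x ∈ c.2.source, f x ∈ d.2.source →
      ContDiffAt ℝ ∞ (fun v => d.2 (f (c.2.symm v))) (c.2 x)) : SmoothInCharts c d f := by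
  rintro v ⟨hv, hfv⟩
  have := h (c.2.symm v) (c.2.map_target hv) hfv
  rw [c.2.right_inv hv] at this
  exact this.contDiffWithinAt

theorem contDiffAt_of_smoothInCharts {X Y : Type} [TopologicalSpace X] [TopologicalSpace Y]
    {c : EuclideanChart X} {d : EuclideanChart Y} {f : X → Y} (hf : Continuous f)
    (h : SmoothInCharts c d f) {x : X} (hx : x ∈ c.2.source) (hfx : f x ∈ d.2.source) :
    ContDiffAt ℝ ∞ (fun v => d.2 (f (c.2.symm v))) (c.2 x) := by
  refine ContDiffOn.contDiffAt h (IsOpen.mem_nhds ?_ ⟨c.2.map_source hx, ?_⟩)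
  · exact c.2.isOpen_inter_preimage_symm (d.2.open_source.preimage hf)
  · rwa [c.2.left_inv hx]

theorem isSmooth_id (M : Man) : IsSmooth (fun x : M => x) :=
  ⟨continuous_id, M.compatible⟩

theorem IsSmooth.comp {M N P : Man} {g : N → P} {f : M → N} (hg : IsSmooth g) (hf : IsSmooth f) :
    IsSmooth (fun x => g (f x)) := by
  refine ⟨hg.1.comp hf.1, fun c hc e he => smoothInCharts_of_contDiffAt fun x hx hgx => ?_⟩
  obtain ⟨d, hd, hfx⟩ := N.cover (f x)
  have h1 := contDiffAt_of_smoothInCharts hf.1 (hf.2 c hc d hd) hx hfx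
  have h2 := contDiffAt_of_smoothInCharts hg.1 (hg.2 d hd e he) hfx hgx
  have h3 : ContDiffAt ℝ ∞ (fun w => e.2 (g (d.2.symm w))) (d.2 (f (c.2.symm (c.2 x)))) := by
    rwa [c.2.left_inv hx]
  refine (ContDiffAt.comp (c.2 x) h3 h1).congr_of_eventuallyEq ?_
  have hopen : IsOpen (c.2.target ∩ c.2.symm ⁻¹' (f ⁻¹' d.2.source)) :=
    c.2.isOpen_inter_preimage_symm (d.2.open_source.preimage hf.1)
  have hmem : c.2 x ∈ c.2.target ∩ c.2.symm ⁻¹' (f ⁻¹' d.2.source) :=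
    ⟨c.2.map_source hx, by simpa [c.2.left_inv hx] using hfx⟩
  filter_upwards [hopen.mem_nhds hmem] with v hv
  have hv' : f (c.2.symm v) ∈ d.2.source := hv.2
  simp [d.2.left_inv hv']

/-- The morphisms of `Man`: smooth functions. -/
@[ext]
structure Hom (M N : Man) : Type where
  /-- the underlying function -/
  toFun : M → N
  smooth : IsSmooth toFun

/-- The category of smooth manifolds and smooth functions. -/
instance : Category Man where
  Hom := Hom
  id M := ⟨fun x => x, isSmooth_id M⟩
  comp f g := ⟨fun x => g.toFun (f.toFun x), g.smooth.comp f.smooth⟩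

@[ext]
theorem hom_ext {M N : Man} {f g : M ⟶ N} (h : ∀ x, f.toFun x = g.toFun x) : f = g :=
  Hom.ext (funext h)

/-- The one-point manifold, of dimension `0`. -/
def point : Man where
  carrier := Unit
  atlas := {⟨0, (Homeomorph.homeomorphOfUnique Unit
    (EuclideanSpace ℝ (Fin 0))).toOpenPartialHomeomorph⟩}
  cover _ := ⟨_, rfl, Set.mem_univ _⟩
  compatible := by
    rintro c rfl d rfl
    exact contDiff_of_subsingleton.contDiffOn

theorem isSmooth_toPoint (M : Man) : IsSmooth (M := M) (N := point) (fun _ => ()) := by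
  refine ⟨continuous_const, ?_⟩
  rintro c - d rfl
  exact contDiff_const.contDiffOn

/-- The product of a chart onto an open subset of `ℝᵐ` and a chart onto an open subset of `ℝⁿ`:
a chart onto an open subset of `ℝᵐ⁺ⁿ = ℝᵐ × ℝⁿ`. -/
noncomputable def prodChart {X Y : Type} [TopologicalSpace X] [TopologicalSpace Y]
    (c : EuclideanChart X) (d : EuclideanChart Y) : EuclideanChart (X × Y) :=
  ⟨c.1 + d.1, (c.2.prod d.2).transHomeomorph
    (EuclideanSpace.finAddEquivProd (𝕜 := ℝ) (n := c.1) (m := d.1)).symm.toHomeomorph⟩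

theorem smoothInCharts_fst {X Y Z : Type} [TopologicalSpace X] [TopologicalSpace Y]
    [TopologicalSpace Z] {c : EuclideanChart X} {d : EuclideanChart Y} {e : EuclideanChart Z}
    {f : X → Z} (h : SmoothInCharts c e f) :
    SmoothInCharts (prodChart c d) e (fun p => f p.1) := by
  let L := EuclideanSpace.finAddEquivProd (𝕜 := ℝ) (n := c.1) (m := d.1)
  have hL : ContDiff ℝ ∞ (fun v => (L v).1) := contDiff_fst.comp L.contDiff
  unfold SmoothInCharts at h
  exact h.comp hL.contDiffOn fun v hv => ⟨hv.1.1, hv.2⟩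

theorem smoothInCharts_snd {X Y Z : Type} [TopologicalSpace X] [TopologicalSpace Y]
    [TopologicalSpace Z] {c : EuclideanChart X} {d : EuclideanChart Y} {e : EuclideanChart Z}
    {f : Y → Z} (h : SmoothInCharts d e f) :
    SmoothInCharts (prodChart c d) e (fun p => f p.2) := by
  let L := EuclideanSpace.finAddEquivProd (𝕜 := ℝ) (n := c.1) (m := d.1)
  have hL : ContDiff ℝ ∞ (fun v => (L v).2) := contDiff_snd.comp L.contDiff
  unfold SmoothInCharts at h
  exact h.comp hL.contDiffOn fun v hv => ⟨hv.1.2, hv.2⟩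

theorem smoothInCharts_prodMk {X Y Z : Type} [TopologicalSpace X] [TopologicalSpace Y]
    [TopologicalSpace Z] {c : EuclideanChart X} {d : EuclideanChart Y} {e : EuclideanChart Z}
    {f : Z → X} {g : Z → Y} (hf : SmoothInCharts e c f) (hg : SmoothInCharts e d g) :
    SmoothInCharts e (prodChart c d) (fun z => (f z, g z)) := by
  let L := EuclideanSpace.finAddEquivProd (𝕜 := ℝ) (n := c.1) (m := d.1)
  exact L.symm.contDiff.comp_contDiffOn
    (ContDiffOn.prodMk (ContDiffOn.mono hf fun v hv => ⟨hv.1, hv.2.1⟩)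
      (ContDiffOn.mono hg fun v hv => ⟨hv.1, hv.2.2⟩))

/-- The product of two manifolds, whose atlas consists of the products of charts. -/
noncomputable def prod (M N : Man) : Man where
  carrier := M × N
  atlas := {e | ∃ c ∈ M.atlas, ∃ d ∈ N.atlas, e = prodChart c d}
  cover p := by
    obtain ⟨c, hc, hpc⟩ := M.cover p.1
    obtain ⟨d, hd, hpd⟩ := N.cover p.2
    exact ⟨_, ⟨c, hc, d, hd, rfl⟩, hpc, hpd⟩
  compatible := by
    rintro _ ⟨c, hc, d, hd, rfl⟩ _ ⟨c', hc', d', hd', rfl⟩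
    exact smoothInCharts_prodMk (smoothInCharts_fst (M.compatible c hc c' hc'))
      (smoothInCharts_snd (N.compatible d hd d' hd'))

theorem isSmooth_fst (M N : Man) : IsSmooth (M := prod M N) (N := M) (fun p => p.1) := by
  refine ⟨continuous_fst, ?_⟩
  rintro _ ⟨c, hc, d, hd, rfl⟩ c' hc'
  exact smoothInCharts_fst (M.compatible c hc c' hc')

theorem isSmooth_snd (M N : Man) : IsSmooth (M := prod M N) (N := N) (fun p => p.2) := by
  refine ⟨continuous_snd, ?_⟩
  rintro _ ⟨c, hc, d, hd, rfl⟩ d' hd'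
  exact smoothInCharts_snd (N.compatible d hd d' hd')

theorem IsSmooth.prodMk {P M N : Man} {f : P → M} {g : P → N} (hf : IsSmooth f)
    (hg : IsSmooth g) : IsSmooth (N := prod M N) (fun x => (f x, g x)) := by
  refine ⟨hf.1.prodMk hg.1, ?_⟩
  rintro e he _ ⟨c, hc, d, hd, rfl⟩
  exact smoothInCharts_prodMk (hf.2 e he c hc) (hg.2 e he d hd)

/-- The one-point manifold is terminal. -/
def isTerminalPoint : IsTerminal point :=
  IsTerminal.ofUniqueHom (fun M => (⟨fun _ => (), isSmooth_toPoint M⟩ : Hom M point))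
    fun _ _ => hom_ext fun _ => rfl

/-- The product manifold with its two projections. -/
noncomputable def prodFan (M N : Man) : BinaryFan M N :=
  BinaryFan.mk (P := prod M N) (⟨fun p => p.1, isSmooth_fst M N⟩ : Hom (prod M N) M)
    (⟨fun p => p.2, isSmooth_snd M N⟩ : Hom (prod M N) N)

/-- The product manifold is the categorical product. -/
noncomputable def isLimitProdFan (M N : Man) : IsLimit (prodFan M N) :=
  BinaryFan.isLimitMk
    (fun s => (⟨fun x => (s.fst.toFun x, s.snd.toFun x), s.fst.smooth.prodMk s.snd.smooth⟩ :
      Hom s.pt (prod M N)))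
    (fun _ => rfl) (fun _ => rfl)
    (fun s _ h₁ h₂ => hom_ext fun x => Prod.ext
      (congrArg (fun k : Hom s.pt M => k.toFun x) h₁)
      (congrArg (fun k : Hom s.pt N => k.toFun x) h₂))

/-- `Man` has finite products: the one-point manifold and the product manifolds. -/
noncomputable instance : CartesianMonoidalCategory Man :=
  CartesianMonoidalCategory.ofChosenFiniteProducts ⟨_, isTerminalPoint⟩
    fun M N => ⟨_, isLimitProdFan M N⟩

end Man

/-!
Suppose that `M` is infinite and that `M × -` has a right adjoint, and let `ℝᴹ` be its value at `ℝ`.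
The points of `ℝᴹ` are the smooth functions on `M`, and `ℝᴹ` has some finite dimension `d` near the
zero function. Choose `k > d` points of `M` and bump functions separating them. The linear
combinations of the bump functions form a smooth family `ℝᵏ → ℝᴹ` through the zero function, and
evaluation at the chosen points is a smooth retraction of it, so its derivative at `0` is
injective and `k ≤ d`.
-/

namespace Man

open MonoidalCategory Topology

variable {M N P : Man} {V W Z : Type}
  [NormedAddCommGroup V] [NormedSpace ℝ V] [FiniteDimensional ℝ V]
  [NormedAddCommGroup W] [NormedSpace ℝ W] [FiniteDimensional ℝ W]
  [NormedAddCommGroup Z] [NormedSpace ℝ Z] [FiniteDimensional ℝ Z]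

theorem isSmooth_const (y : N) : IsSmooth (M := M) (fun _ => y) :=
  ⟨continuous_const, fun _ _ _ _ => contDiff_const.contDiffOn⟩

variable (V) in
/-- A finite-dimensional real vector space as a manifold. Its only chart is a linear isomorphism
onto some `ℝⁿ`, so that the carrier can be `ℝ` or `ι → ℝ` itself. -/
noncomputable abbrev ofVectorSpace : Man where
  carrier := V
  atlas := {⟨_, (toEuclidean (E := V)).toHomeomorph.toOpenPartialHomeomorph⟩}
  cover _ := ⟨_, rfl, Set.mem_univ _⟩
  compatible := by
    rintro c rfl d rfl
    exact (toEuclidean.contDiff.comp toEuclidean.symm.contDiff).contDiffOn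

theorem IsSmooth.contDiffAt_comp_chart_symm {f : M → V} (hf : IsSmooth (N := ofVectorSpace V) f)
    {c : EuclideanChart M} (hc : c ∈ M.atlas) {x : M} (hx : x ∈ c.2.source) :
    ContDiffAt ℝ ∞ (f ∘ c.2.symm) (c.2 x) := by
  have h := contDiffAt_of_smoothInCharts hf.1 (hf.2 c hc _ rfl) hx (Set.mem_univ _)
  exact (toEuclidean (E := V)).comp_contDiffAt_iff.1 h

theorem IsSmooth.contDiffAt_chart_comp {f : V → M} (hf : IsSmooth (M := ofVectorSpace V) f)
    {c : EuclideanChart M} (hc : c ∈ M.atlas) {v : V} (hv : f v ∈ c.2.source) :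
    ContDiffAt ℝ ∞ (c.2 ∘ f) v := by
  have h := contDiffAt_of_smoothInCharts hf.1 (hf.2 _ rfl c hc) (Set.mem_univ v) hv
  have h' := h.comp v (toEuclidean (E := V)).contDiff.contDiffAt
  simpa [Function.comp_def] using h'

theorem isSmooth_of_contDiffAt {f : M → V}
    (hf : ∀ x, ∃ c ∈ M.atlas, x ∈ c.2.source ∧ ContDiffAt ℝ ∞ (f ∘ c.2.symm) (c.2 x)) :
    IsSmooth (N := ofVectorSpace V) f := by
  refine ⟨continuous_iff_continuousAt.2 fun x => ?_, ?_⟩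
  · obtain ⟨c, -, hx, hfc⟩ := hf x
    exact (c.2.symm.continuousAt_iff_continuousAt_comp_right hx).2 hfc.continuousAt
  · rintro c hc _ rfl
    refine smoothInCharts_of_contDiffAt fun x hx _ => toEuclidean.comp_contDiffAt_iff.2 ?_
    obtain ⟨d, hd, hxd, hfd⟩ := hf x
    have htrans : ContDiffAt ℝ ∞ (d.2 ∘ c.2.symm) (c.2 x) :=
      contDiffAt_of_smoothInCharts continuous_id (M.compatible c hc d hd) hx hxd
    have hfdc : ContDiffAt ℝ ∞ ((f ∘ d.2.symm) ∘ (d.2 ∘ c.2.symm)) (c.2 x) :=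
      ContDiffAt.comp _ (by simpa only [Function.comp_apply, c.2.left_inv hx] using hfd) htrans
    refine hfdc.congr_of_eventuallyEq ?_
    filter_upwards [(c.2.tendsto_symm hx).eventually (d.2.eventually_left_inverse hxd)] with v hv
    simp only [Function.comp_apply, hv]

theorem IsSmooth.contDiff_comp₂ {F : V × W → Z} (hF : ContDiff ℝ ∞ F) {f : M → V} {g : M → W}
    (hf : IsSmooth (N := ofVectorSpace V) f) (hg : IsSmooth (N := ofVectorSpace W) g) :
    IsSmooth (N := ofVectorSpace Z) fun x => F (f x, g x) :=
  isSmooth_of_contDiffAt fun x =>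
    let ⟨c, hc, hx⟩ := M.cover x
    ⟨c, hc, hx, hF.contDiffAt.comp _
      ((hf.contDiffAt_comp_chart_symm hc hx).prodMk (hg.contDiffAt_comp_chart_symm hc hx))⟩

theorem isSmooth_pi {ι : Type} [Fintype ι] {f : M → ι → ℝ}
    (hf : ∀ i, IsSmooth (N := ofVectorSpace ℝ) fun x => f x i) :
    IsSmooth (N := ofVectorSpace (ι → ℝ)) f :=
  isSmooth_of_contDiffAt fun x =>
    let ⟨c, hc, hx⟩ := M.cover x
    ⟨c, hc, hx, contDiffAt_pi.2 fun i => (hf i).contDiffAt_comp_chart_symm hc hx⟩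

theorem finrank_le_dim_of_leftInverse {s : V → M} {r : M → V}
    (hs : IsSmooth (M := ofVectorSpace V) s) (hr : IsSmooth (N := ofVectorSpace V) r)
    (hrs : Function.LeftInverse r s) {c : EuclideanChart M} (hc : c ∈ M.atlas) {v : V}
    (hv : s v ∈ c.2.source) : Module.finrank ℝ V ≤ c.1 := by
  have hs' := ((hs.contDiffAt_chart_comp hc hv).differentiableAt (by simp)).hasFDerivAt
  have hr' := ((hr.contDiffAt_comp_chart_symm hc hv).differentiableAt (by simp)).hasFDerivAt
  have hid : (r ∘ c.2.symm) ∘ (c.2 ∘ s) =ᶠ[𝓝 v] id := by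
    filter_upwards [(c.2.open_source.preimage hs.1).mem_nhds hv] with w hw
    simp [c.2.left_inv hw, hrs w]
  have hcomp := (hr'.comp v hs').unique ((hasFDerivAt_id v).congr_of_eventuallyEq hid)
  have hinj : Function.Injective (fderiv ℝ (c.2 ∘ s) v) :=
    Function.LeftInverse.injective fun w => DFunLike.congr_fun hcomp w
  simpa using
    LinearMap.finrank_le_finrank_of_injective (f := (fderiv ℝ (c.2 ∘ s) v).toLinearMap) hinj

theorem isSmooth_indicator_comp_chart {c : EuclideanChart M} (hc : c ∈ M.atlas)
    {b : EuclideanSpace ℝ (Fin c.1) → V} (hb : ContDiff ℝ ∞ b) (hb_compact : HasCompactSupport b)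
    (hb_supp : tsupport b ⊆ c.2.target) :
    IsSmooth (N := ofVectorSpace V) (c.2.source.indicator (b ∘ c.2)) := by
  -- Since `M` is Hausdorff, the support is closed in `M`, not only in the domain of the chart.
  have hK_closed : IsClosed (c.2.symm '' tsupport b) :=
    (hb_compact.isCompact.image_of_continuousOn (c.2.continuousOn_symm.mono hb_supp)).isClosed
  refine isSmooth_of_contDiffAt fun x => ?_
  by_cases hx : x ∈ c.2.source
  · refine ⟨c, hc, hx, hb.contDiffAt.congr_of_eventuallyEq ?_⟩
    filter_upwards [c.2.open_target.mem_nhds (c.2.map_source hx)] with v hv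
    simp [hv]
  · obtain ⟨d, hd, hxd⟩ := M.cover x
    have hxK : x ∉ c.2.symm '' tsupport b := by
      rintro ⟨v, hv, rfl⟩
      exact hx (c.2.map_target (hb_supp hv))
    refine ⟨d, hd, hxd, (contDiffAt_const (c := 0)).congr_of_eventuallyEq ?_⟩
    filter_upwards [(d.2.tendsto_symm hxd).eventually (hK_closed.isOpen_compl.mem_nhds hxK)]
      with v hv
    exact Set.indicator_apply_eq_zero.2 fun hvc =>
      image_eq_zero_of_notMem_tsupport (f := b) fun hvb => hv ⟨_, hvb, c.2.left_inv hvc⟩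

theorem exists_isSmooth_support_subset {x : M} {U : Set M} (hU : U ∈ 𝓝 x) :
    ∃ f : M → ℝ, IsSmooth (N := ofVectorSpace ℝ) f ∧ f x = 1 ∧ Function.support f ⊆ U := by
  obtain ⟨c, hc, hx⟩ := M.cover x
  obtain ⟨b, hb_supp, hb_compact, hb, -, hbx⟩ :=
    exists_contDiff_tsupport_subset (n := ⊤) (Filter.inter_mem
      (c.2.open_target.mem_nhds (c.2.map_source hx)) (c.2.tendsto_symm hx hU))
  refine ⟨_, isSmooth_indicator_comp_chart hc hb hb_compact
    (hb_supp.trans Set.inter_subset_left), by simp [hx, hbx], fun y hy => ?_⟩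
  obtain ⟨hyc, hyb⟩ := Set.indicator_apply_ne_zero.1 hy
  have hyU : c.2.symm (c.2 y) ∈ U := (hb_supp (subset_tsupport b hyb)).2
  rwa [c.2.left_inv hyc] at hyU

theorem exists_isSmooth_eq_single {ι : Type} [Fintype ι] [DecidableEq ι] {x : ι → M}
    (hx : Function.Injective x) :
    ∃ φ : M → ι → ℝ, IsSmooth (N := ofVectorSpace (ι → ℝ)) φ ∧ ∀ i, φ (x i) = Pi.single i 1 := by
  have hU (i : ι) : (x '' {i}ᶜ)ᶜ ∈ 𝓝 (x i) :=
    (Set.toFinite _).isClosed.isOpen_compl.mem_nhds (by simp [hx.eq_iff])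
  choose φ hφ hφ_one hφ_supp using fun i => exists_isSmooth_support_subset (hU i)
  refine ⟨fun y i => φ i y, isSmooth_pi hφ, fun i => funext fun j => ?_⟩
  obtain rfl | hij := eq_or_ne i j
  · simp [hφ_one]
  · rw [Pi.single_eq_of_ne' hij]
    exact Function.notMem_support.1 fun h => hφ_supp j h ⟨i, hij, rfl⟩

section Exponential

variable [Closed M]

/-- Evaluation at `x`, on the points of the exponential object `Nᴹ`. -/
noncomputable def eval (x : M) (y : (ihom M).obj N) : N :=
  ((ihom.ev M).app N).toFun (x, y)

theorem isSmooth_eval (x : M) : IsSmooth (eval (N := N) x) :=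
  ((ihom.ev M).app N).smooth.comp ((isSmooth_const x).prodMk (isSmooth_id _))

theorem eval_curry (f : M ⊗ P ⟶ N) (x : M) (p : P) :
    eval x ((MonoidalClosed.curry f).toFun p) = f.toFun (x, p) := by
  have h := MonoidalClosed.uncurry_curry f
  rw [MonoidalClosed.uncurry_eq] at h
  exact congrArg (fun k : Hom (prod M P) N => k.toFun (x, p)) h

theorem eval_ext {y y' : (ihom M).obj N} (h : ∀ x, eval x y = eval x y') : y = y' := by
  let pt (z : (ihom M).obj N) : point ⟶ (ihom M).obj N := ⟨fun _ => z, isSmooth_const z⟩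
  have hpt : pt y = pt y' := MonoidalClosed.uncurry_injective <| by
    rw [MonoidalClosed.uncurry_eq, MonoidalClosed.uncurry_eq]
    exact hom_ext fun p => h p.1
  exact congrArg (fun k : Hom point _ => k.toFun ()) hpt

theorem card_le_dim_of_eval_eq_zero {ι : Type} [Fintype ι] {x : ι → M}
    (hx : Function.Injective x) {y : (ihom M).obj (ofVectorSpace ℝ)} (hy : ∀ m, eval m y = (0 : ℝ))
    {c : EuclideanChart ((ihom M).obj (ofVectorSpace ℝ))}
    (hc : c ∈ ((ihom M).obj (ofVectorSpace ℝ)).atlas) (hyc : y ∈ c.2.source) :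
    Fintype.card ι ≤ c.1 := by
  classical
  obtain ⟨φ, hφ, hφx⟩ := exists_isSmooth_eq_single hx
  have hdot : ContDiff ℝ ∞ fun p : (ι → ℝ) × (ι → ℝ) => p.1 ⬝ᵥ p.2 := by
    unfold dotProduct
    fun_prop
  let f : M ⊗ ofVectorSpace (ι → ℝ) ⟶ ofVectorSpace ℝ :=
    ⟨fun p => φ p.1 ⬝ᵥ p.2, .contDiff_comp₂ hdot (hφ.comp (isSmooth_fst _ _)) (isSmooth_snd _ _)⟩
  let s := (MonoidalClosed.curry f).toFun
  let r (z : (ihom M).obj (ofVectorSpace ℝ)) (i : ι) : ℝ := eval (x i) z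
  have hrs : Function.LeftInverse r s := fun a => funext fun i =>
    (eval_curry f (x i) a).trans (by simp [f, hφx])
  have hs_zero : s (0 : ι → ℝ) = y := eval_ext fun m => by
    rw [eval_curry, hy]
    simp [f]
  rw [← hs_zero] at hyc
  simpa using finrank_le_dim_of_leftInverse (MonoidalClosed.curry f).smooth
    (isSmooth_pi fun i => isSmooth_eval (x i)) hrs hc hyc

end Exponential

end Man

open Man MonoidalCategory in
theorem mainTheorem8_general (M : Man) [Infinite M] : IsEmpty (Closed M) := by
  refine ⟨fun _ => ?_⟩
  let zero : M ⊗ point ⟶ ofVectorSpace ℝ := ⟨fun _ => (0 : ℝ), isSmooth_const _⟩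
  let y := (MonoidalClosed.curry zero).toFun ()
  obtain ⟨c, hc, hyc⟩ := Man.cover _ y
  have hcard := card_le_dim_of_eval_eq_zero
    (x := fun i : Fin (c.1 + 1) => Infinite.natEmbedding M i)
    ((Infinite.natEmbedding M).injective.comp Fin.val_injective)
    (fun m => eval_curry zero m ()) hc hyc
  simp at hcard

/-- The category of smooth manifolds is not cartesian closed: it has finite products, but not every
functor `M × -` has a right adjoint. -/
theorem mainTheorem8 : ¬ Nonempty (MonoidalClosed Man) :=
  fun ⟨_⟩ =>
    have : Infinite (Man.ofVectorSpace ℝ) := inferInstanceAs (Infinite ℝ)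
    (mainTheorem8_general (Man.ofVectorSpace ℝ)).false inferInstance
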